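/- All graphs are finite and simple. In the independence coloring game on a graph $G$, Alice and Bob proceed in rounds; in round $i=1,2,\dots$ they alternately choose a previously unchosen vertex and give it color $i$, so that the vertices chosen in one round form an independent set. A round ends when no unchosen vertex can be added to the set chosen in that round, and the game ends when all vertices have been chosen. Alice wants to minimize and Bob to maximize the number of rounds. There are four versions: in the A-game (B-game) Alice (Bob) starts every round; in the AB-game (BA-game) Alice (Bob) starts the first round, and each further round is started by the player who did not make the last move of the previous round. The number of rounds under optimal play is $\chi_{ig}^{A}(G)$, $\chi_{ig}^{B}(G)$, $\chi_{ig}^{AB}(G)$, $\chi_{ig}^{BA}(G)$, respectively. The game chromatic number $\chi_g(G)$ is the least number $m$ of colors for which Alice has a winning strategy in the following game: Alice and Bob, Alice first, alternately color an uncolored vertex with one of the $m$ colors so that adjacent vertices never get the same color; Alice wins if all vertices get colored, and Bob wins otherwise. The game coloring number $\mathrm{col}_g(G)$ is the least positive integer $m$ such that, when Alice and Bob, Alice first, alternately mark unmarked vertices, Alice can ensure that at no time (including the start) an unmarked vertex has $m$ marked neighbors. **Theorem.** Every finite forest $F$ satisfies $\chi_g(F)\le \mathrm{col}_g(F)\le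 4$. Moreover, for every positive integer $k$ there exists a finite tree $G$ such that, for each of the four versions $\chi_{ig}\in\{\chi_{ig}^{A},\chi_{ig}^{B},\chi_{ig}^{AB},\chi_{ig}^{BA}\}$, $$\chi_{ig}(G)-\chi_g(G)\ge k .$$ -/

import Mathlib

namespace GraphGames

/-- The two players. -/
inductive Player : Type
  | alice
  | bob

/-- The opponent of a player. -/
def Player.other : Player → Player
  | .alice => .bob
  | .bob => .alice

/-! ### The independence coloring game -/

/-- The four versions of the independence coloring game. -/
inductive Version : Type
  | A
  | B
  | AB
  | BA

/-- The player who makes the first move of the whole game. -/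
def Version.firstPlayer : Version → Player
  | .A => .alice
  | .AB => .alice
  | .B => .bob
  | .BA => .bob

/-- The player who starts the next round, given the player who made the last move of the round
that has just ended. -/
def Version.nextStarter : Version → Player → Player
  | .A, _ => .alice
  | .B, _ => .bob
  | .AB, last => last.other
  | .BA, last => last.other

/-- A position of the independence coloring game: the number of completed rounds, the set of
vertices chosen in the completed rounds, the set of vertices chosen so far in the current round,
and the player whose turn it is. -/
structure IndepPosition (V : Type*) where
  completed : ℕ
  past : Set V
  current : Set V
  turn : Player

/-- The position at the beginning of the game. -/
def IndepPosition.initial (V : Type*) (t : Version) : IndepPosition V where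
  completed := 0
  past := ∅
  current := ∅
  turn := t.firstPlayer

/-- The vertex `v` can be chosen in the current round. -/
def IndepPosition.Legal {V : Type*} (G : SimpleGraph V) (s : IndepPosition V) (v : V) : Prop :=
  v ∉ s.past ∧ v ∉ s.current ∧ ∀ w ∈ s.current, ¬ G.Adj v w

/-- The position in which `v` has just been added to the current round and the turn has passed to
the opponent (whether or not the round has thereby ended). -/
def IndepPosition.add {V : Type*} (s : IndepPosition V) (v : V) : IndepPosition V where
  completed := s.completed
  past := s.past
  current := insert v s.current
  turn := s.turn.other

/-- The position after closing the current round and opening the next one, to be started by `p`. -/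
def IndepPosition.newRound {V : Type*} (s : IndepPosition V) (p : Player) : IndepPosition V where
  completed := s.completed + 1
  past := s.past ∪ s.current
  current := ∅
  turn := p

open Classical in
/-- The position after the player on turn chooses `v`. If afterwards some vertex can still be chosen
in the current round, the round goes on; otherwise it ends. -/
noncomputable def IndepPosition.play {V : Type*} (G : SimpleGraph V) (t : Version)
    (s : IndepPosition V) (v : V) : IndepPosition V :=
  if ∃ w, (s.add v).Legal G w then s.add v
  else (s.add v).newRound (t.nextStarter s.turn)

/-- From the given position Alice has a strategy which guarantees that the game ends after at most
`r` rounds in total (rounds already completed included). -/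
inductive AliceEnsuresRounds {V : Type*} (G : SimpleGraph V) (t : Version) (r : ℕ) :
    IndepPosition V → Prop
  | over (s : IndepPosition V) (hall : ∀ v, v ∈ s.past) (hr : s.completed ≤ r) :
      AliceEnsuresRounds G t r s
  | aliceMove (s : IndepPosition V) (hturn : s.turn = .alice) (v : V) (hv : s.Legal G v)
      (hnext : AliceEnsuresRounds G t r (s.play G t v)) :
      AliceEnsuresRounds G t r s
  | bobMove (s : IndepPosition V) (hturn : s.turn = .bob) (hex : ∃ v, s.Legal G v)
      (hnext : ∀ v, s.Legal G v → AliceEnsuresRounds G t r (s.play G t v)) :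
      AliceEnsuresRounds G t r s

/-- The independence game chromatic number of a finite graph, in the version `t`: the number of
rounds under optimal play, Alice minimizing and Bob maximizing, which is the least `r` such that
Alice can guarantee that at most `r` rounds are played. -/
noncomputable def indepGameChromaticNumber {V : Type*} (t : Version) (G : SimpleGraph V) : ℕ :=
  sInf {r : ℕ | AliceEnsuresRounds G t r (IndepPosition.initial V t)}

/-! ### The coloring game -/

/-- In the partial coloring `c` the vertex `v` is uncolored and may properly be given color `a`. -/
def LegalColor {V : Type*} (G : SimpleGraph V) {k : ℕ} (c : V → Option (Fin k)) (v : V)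
    (a : Fin k) : Prop :=
  c v = none ∧ ∀ w, G.Adj v w → c w ≠ some a

open Classical in
/-- The partial coloring `c` with `v` given color `a`. -/
noncomputable def setColor {V : Type*} {k : ℕ} (c : V → Option (Fin k)) (v : V) (a : Fin k) :
    V → Option (Fin k) :=
  Function.update c v (some a)

/-- With the given partial coloring and the given player on turn, Alice has a strategy which
guarantees that all vertices get colored. A position without a legal move in which some vertex is
uncolored is won by Bob. -/
inductive AliceWinsColoring {V : Type*} (G : SimpleGraph V) (k : ℕ) :
    (V → Option (Fin k)) → Player → Prop
  | over (c : V → Option (Fin k)) (p : Player) (hall : ∀ v, c v ≠ none) :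
      AliceWinsColoring G k c p
  | aliceMove (c : V → Option (Fin k)) (v : V) (a : Fin k) (hv : LegalColor G c v a)
      (hnext : AliceWinsColoring G k (setColor c v a) .bob) :
      AliceWinsColoring G k c .alice
  | bobMove (c : V → Option (Fin k)) (hex : ∃ v a, LegalColor G c v a)
      (hnext : ∀ v a, LegalColor G c v a → AliceWinsColoring G k (setColor c v a) .alice) :
      AliceWinsColoring G k c .bob

/-- The game chromatic number of a finite graph: the least number of colors with which Alice, moving
first, wins the coloring game. -/
noncomputable def gameChromaticNumber {V : Type*} (G : SimpleGraph V) : ℕ :=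
  sInf {k : ℕ | AliceWinsColoring G k (fun _ => none) .alice}

/-! ### The marking game -/

/-- No unmarked vertex has `k` (or more) marked neighbors, where `M` is the set of marked vertices. -/
def MarkSafe {V : Type*} (G : SimpleGraph V) (k : ℕ) (M : Set V) : Prop :=
  ∀ v, v ∉ M → (G.neighborSet v ∩ M).ncard < k

/-- With `M` the set of marked vertices and the given player on turn, Alice has a strategy which
guarantees that now and at every later moment no unmarked vertex has `k` marked neighbors. -/
inductive AlicePreventsMarked {V : Type*} (G : SimpleGraph V) (k : ℕ) : Set V → Player → Prop
  | over (M : Set V) (p : Player) (hall : ∀ v, v ∈ M) : AlicePreventsMarked G k M p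
  | aliceMove (M : Set V) (hsafe : MarkSafe G k M) (v : V) (hv : v ∉ M)
      (hnext : AlicePreventsMarked G k (insert v M) .bob) :
      AlicePreventsMarked G k M .alice
  | bobMove (M : Set V) (hsafe : MarkSafe G k M)
      (hnext : ∀ v, v ∉ M → AlicePreventsMarked G k (insert v M) .alice) :
      AlicePreventsMarked G k M .bob

/-- The game coloring number of a finite graph: the least positive `k` such that Alice, moving
first, can prevent that an unmarked vertex ever has `k` marked neighbors. -/
noncomputable def gameColoringNumber {V : Type*} (G : SimpleGraph V) : ℕ :=
  sInf {k : ℕ | 0 < k ∧ AlicePreventsMarked G k ∅ .alice}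

end GraphGames

/-!
For forests, rootings carry a strategy of Alice for the marking game. Call a vertex active if it
has a marked descendant (or is marked). After each of her moves every unmarked vertex has at most
one active child (`Rooting.Sparse`). When Bob marks `v`, only the first vertex on the way from `v`
to the root that was active before can get a second active child; Alice marks it if this happens
and it is unmarked, and otherwise she marks an unmarked vertex of least depth
(`Rooting.Sparse.exists_reply`). Hence an unmarked vertex never has more than three marked
neighbors: its parent, its active child, and the vertex Bob has just marked. Coloring the vertices
which she would mark, Alice wins the coloring game with as many colors
(`AlicePreventsMarked.aliceWinsColoring`).

For the independence coloring game, consider a tree in which vertices have ranks that increase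
towards the root, every vertex has children of all smaller ranks, and the root has rank `m`. This
is a binomial tree, except that each child occurs in many copies, to make up for the vertices
which Alice chooses. Bob maintains that after `c` rounds no unchosen vertex has an unchosen child
of rank below `c`. Thus the unchosen children of rank `c` of an unchosen vertex `u` have no other
unchosen neighbor than `u`, and as long as `u` can be chosen, Bob can choose such a child instead,
which makes `u` survive the round. He uses this to save one vertex whenever Alice chooses the
first vertex in some group of siblings of equal rank. The groups of round `c + 1` are the classes
of level `c + 1` of a hierarchy of equivalence relations (`TwinTree`): every class of level `c +
1` contains at least two classes of level `c`, each of which has an unchosen member after `c`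
rounds, and so there is another vertex to save. After the round every class of level `c + 1` has
an unchosen member. As the root has children of rank `c` for all `c < m`, the game is not over
after `c < m` rounds, whoever moves when (`TwinTree.le_indepGameChromaticNumber`). Such trees
exist (`TwinVertex.twinTree`), and for `m = k + 4` the bound `4` on the game chromatic number of
forests gives the difference `k`.
-/

namespace GraphGames

/-! ### Rooted forests -/

/-- A rooting of the graph `G`: every edge joins a vertex to its parent, and a parent has smaller
depth than its children. Roots are their own parents. -/
structure Rooting {V : Type*} (G : SimpleGraph V) where
  parent : V → V
  depth : V → ℕ
  adj_cases : ∀ {u v}, G.Adj u v → parent u = v ∧ u ≠ v ∨ parent v = u ∧ v ≠ u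
  depth_parent_lt : ∀ v, parent v ≠ v → depth (parent v) < depth v

/-- In a forest, a vertex has at most one neighbor that is closer to a given vertex `r`, because
such a neighbor is the penultimate vertex of the path from `r`. -/
lemma eq_of_adj_of_dist_lt {V : Type*} {G : SimpleGraph V} (hG : G.IsAcyclic) {r v w w' : V}
    (hr : G.Reachable r v) (hw : G.Adj v w) (hw' : G.Adj v w') (h : G.dist r w < G.dist r v)
    (h' : G.dist r w' < G.dist r v) : w = w' := by
  obtain ⟨p, hp, hpl⟩ := hr.exists_path_of_dist
  have key : ∀ x, G.Adj v x → G.dist r x < G.dist r v → x = p.penultimate := by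
    intro x hx hlt
    refine hG.eq_penultimate_of_adj_end hp hx ?_
    by_contra hxp
    obtain ⟨q, hq, hql⟩ := (hr.trans hx.reachable).exists_path_of_dist
    have hvq := hG.mem_support_of_ne_mem_support_of_adj_of_isPath hq hp hx.symm hxp
    have := congrArg SimpleGraph.Walk.length (hG.path_concat hp hq hx hvq)
    rw [SimpleGraph.Walk.length_concat] at this
    omega
  rw [key w hw h, key w' hw' h']

open Classical in
/-- A forest is rooted by choosing a vertex in each component and measuring depth by the distance
to it. -/
lemma nonempty_rooting {V : Type*} {G : SimpleGraph V} (hG : G.IsAcyclic) :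
    Nonempty (Rooting G) := by
  let r : V → V := fun v => (G.connectedComponentMk v).out
  have hr : ∀ v, G.Reachable (r v) v := fun v =>
    SimpleGraph.ConnectedComponent.exact (Quot.out_eq (G.connectedComponentMk v))
  have hadj : ∀ {u v}, G.Adj u v → r u = r v := fun h => by
    simp only [r, SimpleGraph.ConnectedComponent.sound h.reachable]
  let d : V → ℕ := fun v => G.dist (r v) v
  let par : V → V := fun v => if h : ∃ w, G.Adj v w ∧ d w < d v then h.choose else v
  have hpar : ∀ {v w}, G.Adj v w → d w < d v → par v = w := by
    intro v w hvw hlt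
    have h : ∃ w, G.Adj v w ∧ d w < d v := ⟨w, hvw, hlt⟩
    have hp : par v = h.choose := dif_pos h
    have hs := h.choose_spec
    rw [← hp] at hs
    have h1 := hs.2
    simp only [d, ← hadj hs.1] at h1
    simp only [d, ← hadj hvw] at hlt
    exact eq_of_adj_of_dist_lt hG (hr v) hs.1 hvw h1 hlt
  refine ⟨⟨par, d, ?_, ?_⟩⟩
  · intro u v huv
    have hne : d u ≠ d v := by
      simp only [d, ← hadj huv]
      exact hG.dist_ne_of_adj huv (hr u)
    rcases hne.lt_or_gt with h | h
    · exact .inr ⟨hpar huv.symm h, huv.ne'⟩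
    · exact .inl ⟨hpar huv h, huv.ne⟩
  · intro v hv
    by_cases h : ∃ w, G.Adj v w ∧ d w < d v
    · have hp : par v = h.choose := dif_pos h
      rw [hp]
      exact h.choose_spec.2
    · exact absurd (dif_neg h) hv

/-! ### The marking game on forests -/

namespace Rooting

variable {V : Type*} {G : SimpleGraph V} (R : Rooting G)

/-- The vertex `x` is active when some marked vertex is a descendant of `x` (or `x` itself). -/
def Active (M : Set V) (x : V) : Prop := ∃ m ∈ M, ∃ n, R.parent^[n] m = x

/-- The invariant of Alice's strategy: every unmarked vertex has at most one active child. -/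
def Sparse (M : Set V) : Prop :=
  ∀ x, x ∉ M → ∀ a b, R.parent a = x → R.parent b = x → a ≠ x → b ≠ x →
    R.Active M a → R.Active M b → a = b

variable {R}

lemma depth_parent_le (v : V) : R.depth (R.parent v) ≤ R.depth v := by
  by_cases h : R.parent v = v
  · rw [h]
  · exact (R.depth_parent_lt v h).le

lemma depth_iterate_le (n : ℕ) (v : V) : R.depth (R.parent^[n] v) ≤ R.depth v := by
  induction n with
  | zero => rfl
  | succ n ih =>
    rw [Function.iterate_succ_apply']
    exact (depth_parent_le _).trans ih

lemma depth_lt_of_child {a x : V} (h : R.parent a = x) (hne : a ≠ x) : R.depth x < R.depth a := by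
  subst h
  exact R.depth_parent_lt a hne.symm

lemma active_of_mem {M : Set V} {v : V} (h : v ∈ M) : R.Active M v := ⟨v, h, 0, rfl⟩

lemma Active.iterate {M : Set V} {a : V} (h : R.Active M a) (n : ℕ) :
    R.Active M (R.parent^[n] a) := by
  obtain ⟨m, hm, k, rfl⟩ := h
  exact ⟨m, hm, n + k, Function.iterate_add_apply _ _ _ _⟩

lemma active_insert {M : Set V} {v a : V} (h : R.Active (insert v M) a) :
    R.Active M a ∨ ∃ n, R.parent^[n] v = a := by
  obtain ⟨m, hm, n, rfl⟩ := h
  rcases hm with rfl | hm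
  · exact .inr ⟨n, rfl⟩
  · exact .inl ⟨m, hm, n, rfl⟩

lemma iterate_succ_add {v a x : V} {i j : ℕ} (hi : R.parent^[i] v = a) (ha : R.parent a = x)
    (hij : i < j) : R.parent^[j] v = R.parent^[j - i - 1] x := by
  obtain ⟨k, rfl⟩ := Nat.exists_eq_add_of_lt hij
  rw [show i + k + 1 - i - 1 = k by omega, show i + k + 1 = k + (1 + i) by omega,
    Function.iterate_add_apply, Function.iterate_add_apply, hi, Function.iterate_one, ha]

lemma child_unique_of_iterate {v a b x : V} {i j : ℕ} (hi : R.parent^[i] v = a)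
    (hj : R.parent^[j] v = b) (ha : R.parent a = x) (hb : R.parent b = x) (hax : a ≠ x)
    (hbx : b ≠ x) : a = b := by
  rcases lt_trichotomy i j with h | h | h
  · have h1 := depth_iterate_le (R := R) (j - i - 1) x
    rw [← iterate_succ_add hi ha h, hj] at h1
    exact absurd (depth_lt_of_child hb hbx) h1.not_gt
  · rw [← hi, ← hj, h]
  · have h1 := depth_iterate_le (R := R) (i - j - 1) x
    rw [← iterate_succ_add hj hb h, hi] at h1
    exact absurd (depth_lt_of_child ha hax) h1.not_gt

lemma sparse_empty : R.Sparse ∅ := by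
  rintro x - a b - - - - ⟨m, hm, -⟩
  exact hm.elim

/-- Marking an unmarked vertex of least depth makes no further vertex active except itself, and
its parent, if any, is already marked. -/
lemma Sparse.exists_insert {M : Set V} (h : R.Sparse M) (hM : ∃ v, v ∉ M) :
    ∃ u, u ∉ M ∧ R.Sparse (insert u M) := by
  classical
  have hex : ∃ n, ∃ v, v ∉ M ∧ R.depth v = n := hM.elim fun v hv => ⟨_, v, hv, rfl⟩
  obtain ⟨u, hu, hud⟩ := Nat.find_spec hex
  have hmin : ∀ v, v ∉ M → R.depth u ≤ R.depth v := fun v hv =>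
    hud ▸ Nat.find_min' hex ⟨v, hv, rfl⟩
  refine ⟨u, hu, fun x hx a b ha hb hax hbx hAa hAb => ?_⟩
  have hxM : x ∉ M := fun h => hx (.inr h)
  have key : ∀ c, R.parent c = x → c ≠ x → R.Active (insert u M) c → R.Active M c := by
    intro c hc hcx hA
    refine (active_insert hA).resolve_right ?_
    rintro ⟨n, rfl⟩
    exact absurd ((depth_lt_of_child hc hcx).trans_le (depth_iterate_le n u)) (hmin x hxM).not_gt
  exact h x hxM a b ha hb hax hbx (key a ha hax hAa) (key b hb hbx hAb)

/-- Suppose Bob marks `v` and thereby gives the unmarked vertex `x` a second active child. Then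
`x` is the first vertex on the way from `v` towards the root that was active before; hence it is
the only such vertex, and marking it restores the invariant. -/
lemma Sparse.exists_reply {M : Set V} (h : R.Sparse M) (v : V) (hN : ∃ u, u ∉ insert v M) :
    ∃ u, u ∉ insert v M ∧ R.Sparse (insert u (insert v M)) := by
  by_cases hS : R.Sparse (insert v M)
  · exact hS.exists_insert hN
  have bad : ∀ x, x ∉ insert v M → ∀ a b, R.parent a = x → R.parent b = x → a ≠ x → b ≠ x →
      R.Active (insert v M) a → R.Active (insert v M) b → a ≠ b →
      R.Active M x ∧ ∃ c i, R.parent c = x ∧ R.parent^[i] v = c ∧ ¬ R.Active M c := by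
    intro x hx a b ha hb hax hbx hAa hAb hab
    have hxM : x ∉ M := fun h => hx (.inr h)
    rcases active_insert hAa with hA | ⟨i, hi⟩ <;> rcases active_insert hAb with hB | ⟨j, hj⟩
    · exact absurd (h x hxM a b ha hb hax hbx hA hB) hab
    · exact ⟨ha ▸ hA.iterate 1, b, j, hb, hj, fun hB => hab (h x hxM a b ha hb hax hbx hA hB)⟩
    · exact ⟨hb ▸ hB.iterate 1, a, i, ha, hi, fun hA => hab (h x hxM a b ha hb hax hbx hA hB)⟩
    · exact absurd (child_unique_of_iterate hi hj ha hb hax hbx) hab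
  simp only [Sparse, not_forall] at hS
  obtain ⟨x, hx, a, b, ha, hb, hax, hbx, hAa, hAb, hab⟩ := hS
  refine ⟨x, hx, fun x' hx' a' b' ha' hb' hax' hbx' hAa' hAb' => ?_⟩
  have old : ∀ c, R.Active (insert x (insert v M)) c → R.Active (insert v M) c := by
    intro c hc
    rcases active_insert hc with hc | ⟨n, rfl⟩
    · exact hc
    · exact ha ▸ (hAa.iterate 1).iterate n
  by_contra hab'
  obtain ⟨hxA, c, i, hc, hi, hcA⟩ := bad x hx a b ha hb hax hbx hAa hAb hab
  obtain ⟨hxA', c', i', hc', hi', hcA'⟩ := bad x' (fun h => hx' (.inr h)) a' b' ha' hb' hax' hbx'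
    (old _ hAa') (old _ hAb') hab'
  rcases lt_trichotomy i i' with hlt | rfl | hlt
  · rw [← hi', iterate_succ_add hi hc hlt] at hcA'
    exact hcA' (hxA.iterate _)
  · exact hx' (.inl (by rw [← hc', ← hc, ← hi', ← hi]))
  · rw [← hi, iterate_succ_add hi' hc' hlt] at hcA
    exact hcA (hxA'.iterate _)

/-- If at most one further vertex has been marked since the invariant last held, then an unmarked
vertex has at most three marked neighbors: its parent, its active child, and the new vertex. -/
lemma Sparse.markSafe {M N : Set V} {v : V} (h : R.Sparse M) (hMN : M ⊆ N)
    (hN : N ⊆ insert v M) : MarkSafe G 4 N := by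
  intro x hx
  set C : Set V := {a | a ∈ M ∧ R.parent a = x ∧ a ≠ x} with hC
  have hxM : x ∉ M := fun h => hx (hMN h)
  have hCs : C.Subsingleton := fun a ha b hb =>
    h x hxM a b ha.2.1 hb.2.1 ha.2.2 hb.2.2 (active_of_mem ha.1) (active_of_mem hb.1)
  have hsub : G.neighborSet x ∩ N ⊆ insert (R.parent x) (insert v C) := by
    rintro y ⟨hy, hyN⟩
    rcases R.adj_cases hy with hp | hp
    · exact .inl hp.1.symm
    · rcases hN hyN with rfl | hyM
      · exact .inr (.inl rfl)
      · exact .inr (.inr ⟨hyM, hp⟩)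
  have hfin : (insert (R.parent x) (insert v C)).Finite := (hCs.finite.insert _).insert _
  have h1 := Set.ncard_le_ncard hsub hfin
  have h2 := Set.ncard_insert_le (R.parent x) (insert v C)
  have h3 := Set.ncard_insert_le v C
  have h4 : C.ncard ≤ 1 := (Set.ncard_le_one hCs.finite).2 hCs
  omega

lemma Sparse.alicePreventsMarked [Finite V] {M : Set V} (h : R.Sparse M) :
    AlicePreventsMarked G 4 M .bob := by
  induction hn : Mᶜ.ncard using Nat.strong_induction_on generalizing M with
  | _ n ih =>
  subst hn
  by_cases hM : ∀ v, v ∈ M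
  · exact .over M _ hM
  push Not at hM
  obtain ⟨v₀, hv₀⟩ := hM
  refine .bobMove M (h.markSafe (v := v₀) subset_rfl (Set.subset_insert _ _)) fun v hv => ?_
  by_cases hN : ∀ u, u ∈ insert v M
  · exact .over _ _ hN
  push Not at hN
  obtain ⟨u, hu, hS⟩ := h.exists_reply v hN
  refine .aliceMove _ (h.markSafe (Set.subset_insert _ _) subset_rfl) u hu (ih _ ?_ hS rfl)
  refine Set.ncard_lt_ncard ⟨Set.compl_subset_compl.2 fun x hx => .inr (.inr hx), fun hsub => ?_⟩
  exact hsub hv (.inr (.inl rfl))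

end Rooting

theorem alicePreventsMarked_four_of_isAcyclic {V : Type*} [Finite V] {F : SimpleGraph V}
    (hF : F.IsAcyclic) : AlicePreventsMarked F 4 ∅ .alice := by
  obtain ⟨R⟩ := nonempty_rooting hF
  by_cases hV : ∀ v, v ∈ (∅ : Set V)
  · exact .over _ _ hV
  push Not at hV
  obtain ⟨v, hv⟩ := hV
  have hS : R.Sparse ∅ := Rooting.sparse_empty
  obtain ⟨u, hu, hSu⟩ := hS.exists_insert ⟨v, hv⟩
  exact .aliceMove _ (hS.markSafe (v := v) subset_rfl (Set.subset_insert _ _)) u hu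
    hSu.alicePreventsMarked

/-! ### Coloring by marking -/

/-- A vertex with fewer than `k` colored neighbors can be colored with one of `k` colors. -/
lemma exists_legalColor {V : Type*} [Finite V] {G : SimpleGraph V} {k : ℕ}
    {c : V → Option (Fin k)} (hs : MarkSafe G k {v | c v ≠ none}) {v : V} (hv : c v = none) :
    ∃ a, LegalColor G c v a := by
  classical
  by_contra! hcon
  have hw : ∀ a : Fin k, ∃ w, G.Adj v w ∧ c w = some a := by
    intro a
    by_contra! h
    exact hcon a ⟨hv, h⟩
  choose f hf using hw
  have hinj : Function.Injective f := fun a b hab =>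
    Option.some_injective _ ((hf a).2.symm.trans (hab ▸ (hf b).2))
  have hlt := hs v (fun h => h hv)
  have hsub : Set.range f ⊆ G.neighborSet v ∩ {v | c v ≠ none} := by
    rintro _ ⟨a, rfl⟩
    exact ⟨(hf a).1, by simp [(hf a).2]⟩
  have h1 := Set.ncard_le_ncard hsub (Set.toFinite _)
  rw [← Set.image_univ, Set.ncard_image_of_injective _ hinj, Set.ncard_univ, Nat.card_fin] at h1
  omega

lemma colored_setColor {V : Type*} {k : ℕ} (c : V → Option (Fin k)) (v : V) (a : Fin k) :
    {w | setColor c v a w ≠ none} = insert v {w | c w ≠ none} := by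
  ext w
  by_cases h : w = v <;> simp [setColor, Function.update_apply, h]

/-- Alice wins the coloring game by coloring the vertices that she would mark. -/
lemma AlicePreventsMarked.aliceWinsColoring {V : Type*} [Finite V] {G : SimpleGraph V} {k : ℕ}
    {M : Set V} {p : Player} (h : AlicePreventsMarked G k M p) (c : V → Option (Fin k))
    (hc : {v | c v ≠ none} = M) : AliceWinsColoring G k c p := by
  induction h generalizing c with
  | aliceMove M hsafe v hv hnext ih =>
    subst hc
    have hv' : c v = none := not_not.1 hv
    obtain ⟨a, ha⟩ := exists_legalColor hsafe hv'
    exact .aliceMove c v a ha (ih _ (colored_setColor c v a))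
  | bobMove M hsafe hnext ih =>
    subst hc
    by_cases hall : ∀ v, c v ≠ none
    · exact .over c _ hall
    push Not at hall
    obtain ⟨v, hv⟩ := hall
    refine .bobMove c ⟨v, exists_legalColor hsafe hv⟩ fun w a hw => ?_
    exact ih w (fun h => h hw.1) _ (colored_setColor c w a)
  | _ M p hall =>
    subst hc
    exact .over c p hall

theorem gameColoringNumber_le_four {V : Type*} [Finite V] {F : SimpleGraph V}
    (hF : F.IsAcyclic) : gameColoringNumber F ≤ 4 :=
  Nat.sInf_le ⟨by norm_num, alicePreventsMarked_four_of_isAcyclic hF⟩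

theorem gameChromaticNumber_le_gameColoringNumber {V : Type*} [Finite V] {F : SimpleGraph V}
    (hF : F.IsAcyclic) : gameChromaticNumber F ≤ gameColoringNumber F := by
  have hne : {k : ℕ | 0 < k ∧ AlicePreventsMarked F k ∅ .alice}.Nonempty :=
    ⟨4, by norm_num, alicePreventsMarked_four_of_isAcyclic hF⟩
  exact Nat.sInf_le ((Nat.sInf_mem hne).2.aliceWinsColoring _
    (Set.eq_empty_of_forall_notMem fun _ h => h rfl))

/-! ### Length of the independence coloring game -/

lemma IndepPosition.play_eq {V : Type*} (G : SimpleGraph V) (t : Version) (s : IndepPosition V)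
    (v : V) : s.play G t v = s.add v ∨ (¬ ∃ w, (s.add v).Legal G w) ∧
      ∃ p, s.play G t v = (s.add v).newRound p := by
  by_cases h : ∃ w, (s.add v).Legal G w
  · exact .inl (if_pos h)
  · exact .inr ⟨h, _, if_neg h⟩

/-- Every move chooses a new vertex, so the game ends, and it has at most as many rounds as there
are vertices. -/
lemma aliceEnsuresRounds_of_add_ncard_le {V : Type*} [Finite V] {G : SimpleGraph V} {t : Version}
    {r : ℕ} {s : IndepPosition V} (hs : s.current = ∅ ∨ ∃ v, s.Legal G v)
    (hr : s.completed + (s.past ∪ s.current)ᶜ.ncard ≤ r) : AliceEnsuresRounds G t r s := by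
  induction hn : (s.past ∪ s.current)ᶜ.ncard using Nat.strong_induction_on generalizing s with
  | _ n ih =>
  subst hn
  have next : ∀ v, s.Legal G v → AliceEnsuresRounds G t r (s.play G t v) := by
    intro v hv
    have hlt : (s.past ∪ insert v s.current)ᶜ.ncard < (s.past ∪ s.current)ᶜ.ncard := by
      refine Set.ncard_lt_ncard ⟨Set.compl_subset_compl.2
        (Set.union_subset_union_right _ (Set.subset_insert _ _)), fun hsub => ?_⟩
      exact hsub (show v ∈ (s.past ∪ s.current)ᶜ from fun h => h.elim hv.1 hv.2.1)
        (.inr (.inl rfl))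
    by_cases h : ∃ w, (s.add v).Legal G w
    · rw [show s.play G t v = s.add v from if_pos h]
      exact ih _ hlt (.inr h) (by simp only [IndepPosition.add]; omega) rfl
    · rw [show s.play G t v = (s.add v).newRound _ from if_neg h]
      refine ih _ ?_ (.inl rfl) ?_ rfl <;>
        simp only [IndepPosition.add, IndepPosition.newRound, Set.union_empty] <;> omega
  by_cases hex : ∃ v, s.Legal G v
  · cases ht : s.turn with
    | alice =>
      obtain ⟨v, hv⟩ := hex
      exact .aliceMove s ht v hv (next v hv)
    | bob => exact .bobMove s ht hex next
  · have hc := hs.resolve_right hex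
    refine .over s (fun v => ?_) (by omega)
    by_contra hv
    exact hex ⟨v, hv, by simp [hc], by simp [hc]⟩

lemma le_indepGameChromaticNumber {V : Type*} [Finite V] {G : SimpleGraph V} {t : Version} {m : ℕ}
    (h : ∀ r, AliceEnsuresRounds G t r (IndepPosition.initial V t) → m ≤ r) :
    m ≤ indepGameChromaticNumber t G :=
  le_csInf ⟨_, aliceEnsuresRounds_of_add_ncard_le (.inl rfl) le_rfl⟩ h

/-! ### Bob's strategy on trees with many twins -/

/-- A rooting of `G` in which ranks increase towards the root, whose rank is `m`, and every vertex
has children of all smaller ranks. The children of each rank of each vertex are organized in a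
hierarchy of twin classes: the classes of level `c + 1` are unions of classes of level `c`, and
they are proper unions as long as the vertices have rank above `c`. -/
structure TwinTree {V : Type*} (G : SimpleGraph V) (m : ℕ) where
  root : V
  parent : V → V
  rank : V → ℕ
  Twin : ℕ → V → V → Prop
  adj_iff : ∀ u v, G.Adj u v ↔ u ≠ root ∧ parent u = v ∨ v ≠ root ∧ parent v = u
  rank_root : rank root = m
  rank_lt : ∀ v, v ≠ root → rank v < m
  rank_lt_parent : ∀ v, v ≠ root → rank v < rank (parent v)
  exists_child : ∀ u c, c < rank u → ∃ v, v ≠ root ∧ parent v = u ∧ rank v = c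
  twin_equivalence : ∀ c, Equivalence (Twin c)
  twin_succ : ∀ {c u v}, Twin c u v → Twin (c + 1) u v
  twin_parent : ∀ {c u v}, Twin c u v → parent u = parent v
  twin_rank : ∀ {c u v}, Twin c u v → rank u = rank v
  exists_twin : ∀ v c, v ≠ root → c < rank v → ∃ w, Twin (c + 1) v w ∧ ¬ Twin c v w

namespace TwinTree

variable {V : Type*} {G : SimpleGraph V} {m : ℕ} (T : TwinTree G m)

/-- The twin class of `v` of level `s.completed + 1` is under control: either none of its members
has been chosen in the current round, or it has a member that is certain to survive the round,
being unchosen with a neighbor chosen in this round. -/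
def Controlled (s : IndepPosition V) (v : V) : Prop :=
  (∃ w ∈ s.current, T.Twin (s.completed + 1) v w) →
    ∃ w, T.Twin (s.completed + 1) v w ∧ w ∉ s.past ∧ w ∉ s.current ∧ ∃ u ∈ s.current, G.Adj w u

/-- Some twin of `v` of level `s.completed + 1` has not been chosen so far. -/
def Alive (s : IndepPosition V) (v : V) : Prop :=
  ∃ w, T.Twin (s.completed + 1) v w ∧ w ∉ s.past ∧ w ∉ s.current

/-- What the completed rounds have established: an unchosen vertex has no unchosen child of rank
below `s.completed`, and every other twin class of level `s.completed` has an unchosen member. -/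
structure RoundInvariant (s : IndepPosition V) : Prop where
  disjoint : ∀ v, v ∈ s.current → v ∉ s.past
  low : ∀ v, v ≠ T.root → T.rank v < s.completed → v ∈ s.past ∨ T.parent v ∈ s.past
  high : ∀ v, v ≠ T.root → s.completed ≤ T.rank v → ∃ w, T.Twin s.completed v w ∧ w ∉ s.past

/-- The invariant of Bob's strategy: in ranks above `s.completed`, all twin classes of level
`s.completed + 1` are under control, except that, when it is Bob's turn, one class (that of `y`)
may have lost a member by Alice's last move, as long as an unchosen member is left. -/
def BobInvariant (s : IndepPosition V) : Prop :=
  T.RoundInvariant s ∧ ∃ y, ∀ v, v ≠ T.root → s.completed < T.rank v →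
    T.Controlled s v ∨ s.turn = .bob ∧ T.Twin (s.completed + 1) y v ∧ T.Alive s v

variable {T}

lemma ne_root_of_twin {c : ℕ} {v w : V} (h : T.Twin c v w) (hv : v ≠ T.root) : w ≠ T.root := by
  rintro rfl
  have := T.rank_lt v hv
  rw [T.twin_rank h, T.rank_root] at this
  exact this.false

lemma adj_parent {v : V} (hv : v ≠ T.root) : G.Adj v (T.parent v) :=
  (T.adj_iff _ _).2 (.inl ⟨hv, rfl⟩)

lemma RoundInvariant.add {s : IndepPosition V} (h : T.RoundInvariant s) {v : V} (hv : s.Legal G v) :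
    T.RoundInvariant (s.add v) where
  disjoint := by
    rintro w (rfl | hw)
    · exact hv.1
    · exact h.disjoint w hw
  low := h.low
  high := h.high

/-- A class of level `s.completed + 1` splits into at least two classes of level `s.completed`, so
it has two unchosen members at the beginning of the round. -/
lemma RoundInvariant.exists_twin_ne {s : IndepPosition V} (h : T.RoundInvariant s) {v : V}
    (hv : v ≠ T.root) (hr : s.completed < T.rank v) (x : V) :
    ∃ w, T.Twin (s.completed + 1) v w ∧ w ∉ s.past ∧ w ≠ x := by
  obtain ⟨w₁, h₁, h₁'⟩ := h.high v hv hr.le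
  obtain ⟨u, hu, hu'⟩ := T.exists_twin v _ hv hr
  obtain ⟨w₂, h₂, h₂'⟩ := h.high u (ne_root_of_twin hu hv) (T.twin_rank hu ▸ hr.le)
  by_cases hx : w₁ = x
  · refine ⟨w₂, (T.twin_equivalence _).trans hu (T.twin_succ h₂), h₂', ?_⟩
    rintro rfl
    subst hx
    exact hu' ((T.twin_equivalence _).trans h₁ ((T.twin_equivalence _).symm h₂))
  · exact ⟨w₁, T.twin_succ h₁, h₁', hx⟩

lemma Controlled.alive {s : IndepPosition V} {v : V} (hs : T.Controlled s v)
    (h : T.RoundInvariant s) (hv : v ≠ T.root) (hr : s.completed < T.rank v) : T.Alive s v := by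
  by_cases hc : ∃ w ∈ s.current, T.Twin (s.completed + 1) v w
  · obtain ⟨w, hw, hwp, hwc, -⟩ := hs hc
    exact ⟨w, hw, hwp, hwc⟩
  · obtain ⟨w, hw, hwp, -⟩ := h.exists_twin_ne hv hr v
    exact ⟨w, hw, hwp, fun hwc => hc ⟨w, hwc, hw⟩⟩

lemma controlled_of_current_eq_empty {s : IndepPosition V} (h : s.current = ∅) (v : V) :
    T.Controlled s v := by
  rintro ⟨w, hw, -⟩
  rw [h] at hw
  exact hw.elim

/-- A controlled class remains so under a move outside it, and, once one of its members has been
chosen, under any move. -/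
lemma Controlled.add {s : IndepPosition V} {v x : V} (hs : T.Controlled s v) (hx : s.Legal G x)
    (h : T.Twin (s.completed + 1) v x → ∃ w ∈ s.current, T.Twin (s.completed + 1) v w) :
    T.Controlled (s.add x) v := by
  rintro ⟨w, hw, hvw⟩
  have hold : ∃ w ∈ s.current, T.Twin (s.completed + 1) v w := by
    rcases hw with rfl | hw
    · exact h hvw
    · exact ⟨w, hw, hvw⟩
  obtain ⟨w', h1, h2, h3, u, hu, hwu⟩ := hs hold
  refine ⟨w', h1, h2, ?_, u, .inr hu, hwu⟩
  rintro (rfl | h4)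
  · exact hx.2.2 u hu hwu
  · exact h3 h4

/-- When a round is over, no vertex of rank `s.completed` is unchosen together with its parent,
since it could then still be chosen, and no class of level `s.completed + 1` has been exhausted. -/
lemma BobInvariant.newRound {s : IndepPosition V} (h : T.BobInvariant s)
    (hend : ¬ ∃ w, s.Legal G w) (p : Player) : T.BobInvariant (s.newRound p) := by
  obtain ⟨hb, y, hy⟩ := h
  refine ⟨⟨fun v hv => hv.elim, fun v hv hr => ?_, fun v hv hr => ?_⟩, y, fun v _ _ =>
    .inl (controlled_of_current_eq_empty rfl v)⟩
  · change T.rank v < s.completed + 1 at hr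
    rcases (Nat.lt_succ_iff.1 hr).lt_or_eq with hr | hr
    · exact (hb.low v hv hr).imp .inl .inl
    · by_contra! hcon
      obtain ⟨h1, h2⟩ := hcon
      refine hend ⟨v, fun h => h1 (.inl h), fun h => h1 (.inr h), fun w hw hvw => ?_⟩
      rcases (T.adj_iff _ _).1 hvw with ⟨-, rfl⟩ | ⟨hw', rfl⟩
      · exact h2 (.inr hw)
      · rcases hb.low w hw' (hr ▸ T.rank_lt_parent w hw') with h | h
        · exact hb.disjoint w hw h
        · exact h1 (.inl h)
  · have hA : T.Alive s v := by
      rcases hy v hv hr with hc | hc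
      · exact hc.alive hb hv hr
      · exact hc.2.2
    obtain ⟨w, h1, h2, h3⟩ := hA
    exact ⟨w, h1, fun h => h.elim h2 h3⟩

lemma BobInvariant.play {s : IndepPosition V} {v : V} (h : T.BobInvariant (s.add v)) (t : Version) :
    T.BobInvariant (s.play G t v) := by
  rcases s.play_eq G t v with hp | ⟨hend, p, hp⟩ <;> rw [hp]
  · exact h
  · exact h.newRound hend p

lemma BobInvariant.add_of_alice {s : IndepPosition V} (h : T.BobInvariant s)
    (ht : s.turn = .alice) {x : V} (hx : s.Legal G x) : T.BobInvariant (s.add x) := by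
  obtain ⟨hb, y, hy⟩ := h
  refine ⟨hb.add hx, x, fun v hv hr => ?_⟩
  have hc : T.Controlled s v := (hy v hv hr).resolve_right fun h => by simp [ht] at h
  by_cases hold : T.Twin (s.completed + 1) v x → ∃ w ∈ s.current, T.Twin (s.completed + 1) v w
  · exact .inl (hc.add hx hold)
  · push Not at hold
    obtain ⟨hvx, hno⟩ := hold
    obtain ⟨w, hw, hwp, hwx⟩ := hb.exists_twin_ne hv hr x
    refine .inr ⟨?_, (T.twin_equivalence _).symm hvx, w, hw, hwp, ?_⟩
    · simp [IndepPosition.add, ht, Player.other]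
    · rintro (rfl | hwc)
      · exact hwx rfl
      · exact hno w hwc hw

/-- As long as a vertex `u` of rank above `s.completed` can be chosen, so can one of its children
of rank `s.completed`, whose only unchosen neighbor is `u`. -/
lemma RoundInvariant.exists_legal_child {s : IndepPosition V} (h : T.RoundInvariant s) {u : V}
    (hu : s.Legal G u) (hr : s.completed < T.rank u) :
    ∃ z, s.Legal G z ∧ G.Adj u z ∧ T.rank z = s.completed := by
  obtain ⟨z₀, h0, hp0, hr0⟩ := T.exists_child u _ hr
  obtain ⟨z, hz, hzp⟩ := h.high z₀ h0 hr0.ge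
  have hz0 := ne_root_of_twin hz h0
  have hpz : T.parent z = u := T.twin_parent hz ▸ hp0
  have hrz : T.rank z = s.completed := T.twin_rank hz ▸ hr0
  have huz : G.Adj u z := (hpz ▸ adj_parent hz0).symm
  refine ⟨z, ⟨hzp, fun hzc => hu.2.2 z hzc huz, fun w hw hzw => ?_⟩, huz, hrz⟩
  rcases (T.adj_iff _ _).1 hzw with ⟨-, rfl⟩ | ⟨hw', hpw⟩
  · exact hu.2.1 (hpz ▸ hw)
  · rcases h.low w hw' (hrz ▸ hpw ▸ T.rank_lt_parent w hw') with h' | h'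
    · exact h.disjoint w hw h'
    · exact hzp (hpw ▸ h')

/-- Bob restores control over the class that Alice has attacked, if there is one, by choosing a child
of one of its unchosen members; otherwise he makes any move in rank at most `s.completed`. -/
lemma BobInvariant.exists_add {s : IndepPosition V} (h : T.BobInvariant s)
    (hex : ∃ v, s.Legal G v) : ∃ z, s.Legal G z ∧ T.BobInvariant (s.add z) := by
  obtain ⟨hb, y, hy⟩ := h
  -- Bob never chooses a vertex of rank above `s.completed`, so every controlled class stays so.
  have keep : ∀ z, s.Legal G z → T.rank z ≤ s.completed → ∀ v, s.completed < T.rank v →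
      T.Controlled s v → T.Controlled (s.add z) v := fun z hz hrz v hr hc =>
    hc.add hz fun htw => absurd hr (T.twin_rank htw ▸ hrz).not_gt
  by_cases hall : ∀ v, v ≠ T.root → s.completed < T.rank v → T.Controlled s v
  · have hz : ∃ z, s.Legal G z ∧ T.rank z ≤ s.completed := by
      obtain ⟨u, hu⟩ := hex
      by_cases hr : s.completed < T.rank u
      · obtain ⟨z, hz, -, hrz⟩ := hb.exists_legal_child hu hr
        exact ⟨z, hz, hrz.le⟩
      · exact ⟨u, hu, not_lt.1 hr⟩
    obtain ⟨z, hz, hrz⟩ := hz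
    exact ⟨z, hz, hb.add hz, y, fun v hv hr => .inl (keep z hz hrz v hr (hall v hv hr))⟩
  · push Not at hall
    obtain ⟨v, hv, hr, hc⟩ := hall
    obtain ⟨-, hyv, w, hvw, hwp, hwc⟩ := (hy v hv hr).resolve_left hc
    have hw : s.Legal G w := by
      refine ⟨hwp, hwc, fun u hu hwu => hc fun _ => ⟨w, hvw, hwp, hwc, u, hu, hwu⟩⟩
    obtain ⟨z, hz, hwz, hrz⟩ := hb.exists_legal_child hw (T.twin_rank hvw ▸ hr)
    refine ⟨z, hz, hb.add hz, y, fun v' hv' hr' => .inl ?_⟩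
    rcases hy v' hv' hr' with hc' | ⟨-, hyv', -⟩
    · exact keep z hz hrz.le v' hr' hc'
    · -- The class of `v'` is the attacked one, and now its member `w` survives the round.
      refine fun _ => ⟨w, ?_, hwp, ?_, z, .inl rfl, hwz⟩
      · exact (T.twin_equivalence _).trans ((T.twin_equivalence _).symm hyv')
          ((T.twin_equivalence _).trans hyv hvw)
      · rintro (rfl | h)
        · exact hwz.ne rfl
        · exact hwc h

lemma BobInvariant.le_of_aliceEnsuresRounds {t : Version} {r : ℕ} {s : IndepPosition V}
    (hs : T.BobInvariant s) (h : AliceEnsuresRounds G t r s) : m ≤ r := by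
  induction h with
  | aliceMove s hturn v hv _ ih => exact ih ((hs.add_of_alice hturn hv).play t)
  | bobMove s _ hex _ ih =>
    obtain ⟨z, hz, hinv⟩ := hs.exists_add hex
    exact ih z hz (hinv.play t)
  | _ s hall hr =>
    refine le_trans (not_lt.1 fun hlt => ?_) hr
    obtain ⟨v, hv, -, hrv⟩ := T.exists_child T.root s.completed (by rwa [T.rank_root])
    obtain ⟨w, -, hw⟩ := hs.1.high v hv hrv.ge
    exact hw (hall w)

lemma bobInvariant_initial (t : Version) : T.BobInvariant (IndepPosition.initial V t) :=
  ⟨⟨fun _ hv => hv.elim, fun _ _ hr => absurd hr (Nat.not_lt_zero _), fun v _ _ =>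
    ⟨v, (T.twin_equivalence _).refl v, fun h => h⟩⟩, T.root, fun v _ _ =>
    .inl (controlled_of_current_eq_empty rfl v)⟩

theorem le_indepGameChromaticNumber [Finite V] (T : TwinTree G m) (t : Version) :
    m ≤ indepGameChromaticNumber t G :=
  GraphGames.le_indepGameChromaticNumber fun _ h =>
    (bobInvariant_initial (T := T) t).le_of_aliceEnsuresRounds h

lemma isTree [Finite V] (T : TwinTree G m) : G.IsTree := by
  have hreach : ∀ v, G.Reachable v T.root := by
    intro v
    induction hn : m - T.rank v using Nat.strong_induction_on generalizing v with
    | _ n ih =>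
    subst hn
    by_cases hv : v = T.root
    · rw [hv]
    · have h1 := T.rank_lt v hv
      have h2 := T.rank_lt_parent v hv
      exact (adj_parent hv).reachable.trans (ih _ (by omega) _ rfl)
  have hconn : G.Connected :=
    { preconnected := fun u v => (hreach u).trans (hreach v).symm, nonempty := ⟨T.root⟩ }
  refine SimpleGraph.isTree_iff_connected_and_card.2
    ⟨hconn, le_antisymm ?_ hconn.card_vert_le_card_edgeSet_add_one⟩
  -- Every edge joins a vertex other than the root to its parent.
  have hsub : G.edgeSet ⊆ (fun v => s(v, T.parent v)) '' {T.root}ᶜ := by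
    intro e he
    induction e with
    | _ u v =>
    rcases (T.adj_iff u v).1 he with ⟨h, rfl⟩ | ⟨h, rfl⟩
    · exact ⟨u, h, rfl⟩
    · exact ⟨v, h, Sym2.eq_swap⟩
  have h1 := Set.ncard_le_ncard hsub (Set.toFinite _)
  have h2 := Set.ncard_image_le (f := fun v => s(v, T.parent v)) (Set.toFinite ({T.root}ᶜ : Set V))
  have h3 := Set.ncard_add_ncard_compl ({T.root} : Set V)
  rw [Set.ncard_singleton] at h3
  rw [← Nat.card_coe_set_eq] at h1
  omega

end TwinTree

/-! ### Construction of the trees -/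

/-- The vertices of the tree in which every vertex of rank `n` has `2 ^ m` children of each rank
`i < n`. A child of rank `i` is reached by an edge labelled by `i` and by a binary word of length
`m`, and a vertex is encoded by the labels on its path from the root: `x i = some e` if the path
contains an edge labelled by `i` and `e`. -/
abbrev TwinVertex (m : ℕ) : Type := Fin m → Option (Fin m → Bool)

namespace TwinVertex

variable {m : ℕ}

/-- The rank of a vertex is the least label on its path from the root; the root has rank `m`. -/
def rank (x : TwinVertex m) : ℕ :=
  Nat.find (p := fun n => ∀ h : n < m, x ⟨n, h⟩ ≠ none) ⟨m, fun h => absurd h (lt_irrefl m)⟩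

/-- The parent of a vertex; the root is its own parent. -/
def parent (x : TwinVertex m) : TwinVertex m :=
  if h : x.rank < m then Function.update x ⟨x.rank, h⟩ none else x

/-- The binary word on the edge from a vertex to its parent, with a junk value at the root. -/
def word (x : TwinVertex m) : Fin m → Bool :=
  if h : x.rank < m then (x ⟨x.rank, h⟩).getD default else default

/-- The child of rank `i` that belongs to the word `e`, provided that `i` is less than the rank. -/
def child (x : TwinVertex m) (i : Fin m) (e : Fin m → Bool) : TwinVertex m :=
  Function.update x i (some e)

lemma rank_eq_iff {x : TwinVertex m} {i : Fin m} :
    x.rank = i ↔ x i ≠ none ∧ ∀ j < i, x j = none := by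
  rw [rank, Nat.find_eq_iff]
  constructor
  · rintro ⟨h1, h2⟩
    refine ⟨h1 i.2, fun j hj => ?_⟩
    have := h2 j hj
    push Not at this
    exact this.2
  · rintro ⟨h1, h2⟩
    exact ⟨fun _ => h1, fun n hn h => h (hn.trans i.2) (h2 ⟨n, hn.trans i.2⟩ hn)⟩

lemma eq_none_of_lt_rank {x : TwinVertex m} {j : Fin m} (h : (j : ℕ) < x.rank) : x j = none := by
  have := Nat.find_min _ h
  push Not at this
  exact this.2

lemma lt_rank {x : TwinVertex m} {i : ℕ} (hi : i < m) (h : ∀ j : Fin m, (j : ℕ) ≤ i → x j = none) :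
    i < x.rank := by
  by_contra! hle
  have hm : x.rank < m := hle.trans_lt hi
  exact (rank_eq_iff (i := ⟨x.rank, hm⟩).1 rfl).1 (h _ hle)

lemma rank_root : rank (fun _ => none : TwinVertex m) = m :=
  (Nat.find_eq_iff _).2 ⟨fun h => absurd h (lt_irrefl m), fun _ hn h => h hn rfl⟩

lemma rank_le (x : TwinVertex m) : x.rank ≤ m :=
  Nat.find_min' _ fun h => absurd h (lt_irrefl m)

lemma rank_lt {x : TwinVertex m} (h : x ≠ fun _ => none) : x.rank < m := by
  by_contra! hle
  exact h (funext fun j => eq_none_of_lt_rank (j.2.trans_le hle))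

lemma rank_child {x : TwinVertex m} {i : Fin m} (h : (i : ℕ) < x.rank) (e : Fin m → Bool) :
    (x.child i e).rank = i := by
  refine rank_eq_iff.2 ⟨by simp [child], fun j hj => ?_⟩
  rw [child, Function.update_of_ne hj.ne]
  exact eq_none_of_lt_rank (lt_trans hj h)

lemma parent_child {x : TwinVertex m} {i : Fin m} (h : (i : ℕ) < x.rank) (e : Fin m → Bool) :
    (x.child i e).parent = x := by
  have hr := rank_child h e
  have hi : (⟨(x.child i e).rank, hr ▸ i.2⟩ : Fin m) = i := Fin.ext hr
  rw [parent, dif_pos (hr ▸ i.2), hi, child, Function.update_idem, Function.update_eq_self_iff]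
  exact (eq_none_of_lt_rank h).symm

lemma word_child {x : TwinVertex m} {i : Fin m} (h : (i : ℕ) < x.rank) (e : Fin m → Bool) :
    (x.child i e).word = e := by
  have hr := rank_child h e
  have hi : (⟨(x.child i e).rank, hr ▸ i.2⟩ : Fin m) = i := Fin.ext hr
  rw [word, dif_pos (hr ▸ i.2), hi]
  simp [child]

lemma rank_lt_rank_parent {x : TwinVertex m} (h : x ≠ fun _ => none) : x.rank < x.parent.rank := by
  have hm := rank_lt h
  refine lt_rank hm fun j hj => ?_
  rw [parent, dif_pos hm, Function.update_apply]
  split_ifs with hji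
  · rfl
  · exact eq_none_of_lt_rank (lt_of_le_of_ne hj fun h => hji (Fin.ext h))

lemma ne_root_of_rank_lt {x : TwinVertex m} (h : x.rank < m) : x ≠ fun _ => none := by
  rintro rfl
  exact (rank_root ▸ h).false

/-- The tree on `TwinVertex m`. -/
def tree (m : ℕ) : SimpleGraph (TwinVertex m) where
  Adj u v := (u ≠ fun _ => none) ∧ u.parent = v ∨ (v ≠ fun _ => none) ∧ v.parent = u
  symm := ⟨fun _ _ h => h.symm⟩
  loopless := ⟨fun u h => by
    obtain ⟨h1, h2⟩ : (u ≠ fun _ => none) ∧ u.parent = u := h.elim id id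
    have := rank_lt_rank_parent h1
    rw [h2] at this
    exact this.false⟩

/-- Siblings of the same rank are twins of level `c` if their words agree from position `c` on. -/
def twinTree (m : ℕ) : TwinTree (tree m) m where
  root := fun _ => none
  parent := parent
  rank := rank
  Twin c u v := u.parent = v.parent ∧ u.rank = v.rank ∧ ∀ j : Fin m, c ≤ j → u.word j = v.word j
  adj_iff _ _ := Iff.rfl
  rank_root := rank_root
  rank_lt _ := rank_lt
  rank_lt_parent _ := rank_lt_rank_parent
  exists_child u c hc := by
    have hm : c < m := hc.trans_le (rank_le u)
    have hr := rank_child (x := u) (i := ⟨c, hm⟩) hc default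
    exact ⟨u.child ⟨c, hm⟩ default, ne_root_of_rank_lt (hr.trans_lt hm), parent_child hc _, hr⟩
  twin_equivalence c :=
    { refl := fun _ => ⟨rfl, rfl, fun _ _ => rfl⟩
      symm := fun h => ⟨h.1.symm, h.2.1.symm, fun j hj => (h.2.2 j hj).symm⟩
      trans := fun h h' => ⟨h.1.trans h'.1, h.2.1.trans h'.2.1,
        fun j hj => (h.2.2 j hj).trans (h'.2.2 j hj)⟩ }
  twin_succ h := ⟨h.1, h.2.1, fun j hj => h.2.2 j ((Nat.le_succ _).trans hj)⟩
  twin_parent h := h.1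
  twin_rank h := h.2.1
  exists_twin v c hv hc := by
    have hm := rank_lt hv
    let i : Fin m := ⟨v.rank, hm⟩
    let k : Fin m := ⟨c, hc.trans hm⟩
    have hi : (i : ℕ) < v.parent.rank := rank_lt_rank_parent hv
    -- The words of twins of level `c + 1` may differ at position `c`.
    refine ⟨v.parent.child i (Function.update v.word k (!v.word k)),
      ⟨(parent_child hi _).symm, (rank_child hi _).symm, fun j hj => ?_⟩, fun h => ?_⟩
    · rw [word_child hi, Function.update_of_ne]
      rintro rfl
      exact absurd hj (Nat.not_succ_le_self c)
    · have := h.2.2 k le_rfl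
      rw [word_child hi, Function.update_self] at this
      simp at this

end TwinVertex

end GraphGames

theorem mainTheorem9 :
    (∀ (V : Type*) [Finite V] (F : SimpleGraph V), F.IsAcyclic →
      GraphGames.gameChromaticNumber F ≤ GraphGames.gameColoringNumber F ∧
        GraphGames.gameColoringNumber F ≤ 4) ∧
    ∀ k : ℕ, 0 < k → ∃ (V : Type) (_ : Finite V) (G : SimpleGraph V), G.IsTree ∧
      ∀ t : GraphGames.Version,
        (k : ℤ) ≤ (GraphGames.indepGameChromaticNumber t G : ℤ) -
          (GraphGames.gameChromaticNumber G : ℤ) := by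
  refine ⟨fun V _ F hF => ⟨GraphGames.gameChromaticNumber_le_gameColoringNumber hF,
    GraphGames.gameColoringNumber_le_four hF⟩, fun k _ => ?_⟩
  have hT := (GraphGames.TwinVertex.twinTree (k + 4)).isTree
  refine ⟨GraphGames.TwinVertex (k + 4), inferInstance, GraphGames.TwinVertex.tree (k + 4), hT,
    fun t => ?_⟩
  have h1 := (GraphGames.TwinVertex.twinTree (k + 4)).le_indepGameChromaticNumber t
  have h2 := GraphGames.gameChromaticNumber_le_gameColoringNumber hT.isAcyclic
  have h3 := GraphGames.gameColoringNumber_le_four hT.isAcyclic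
  omega
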